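/- **Setting.** Let $\mathrm{AP}$ be a set of atomic propositions consisting of basic propositions $p\in P$ and their negations $\overline p$. A (finite) Markov chain $M=(S,P_M,\rho,s_{\mathrm{in}})$ has a finite set $S$ of states, transition probabilities $P_M:S\times S\to[0,1]$ with $\sum_{s'}P_M(s,s')=1$ for every $s$, a labelling $\rho:\mathrm{AP}\to 2^S$ with $\rho(\overline p)=S\setminus\rho(p)$, and an initial state. Types are $\tau::=\mathsf{Prop}\mid\tau_1\to\tau_2$, with $\mathrm{order}(\mathsf{Prop})=0$ and $\mathrm{order}(\tau_1\to\tau_2)=\max(\mathrm{order}(\tau_1)+1,\mathrm{order}(\tau_2))$. PHFL formulas are the simply typed formulas $$\varphi::=p\mid X\mid\varphi\lor\varphi\mid\varphi\land\varphi\mid[\varphi]_J\mid\square\varphi\mid\lozenge\varphi\mid\bigcirc\varphi\mid\mu X.\varphi\mid\nu X.\varphi\mid\lambda X.\varphi\mid\varphi\,\varphi,$$ where $p\in\mathrm{AP}$ and $J$ is "$>r$" ($0\le r<1$) or "$\ge r$" ($0<r\le1$), $r$ rational; all connectives and modalities act on type $\mathsf{Prop}$, and in $\mu X.\varphi$ and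 $\nu X.\varphi$ the variable $X$ and the body $\varphi$ have the same, arbitrary type. Over $M$, $\mathsf{Prop}$ denotes the functions $S\to[0,1]$ and $\tau_1\to\tau_2$ the monotone functions, both ordered pointwise; $\lor,\land$ are pointwise maximum and minimum, $[\varphi]_J$ is $1$ where the value of $\varphi$ is in $J$ and $0$ elsewhere, $\square,\lozenge,\bigcirc$ are the minimum and the maximum over the successors of positive probability and the expectation after one step, and $\mu,\nu$ are least and greatest fixpoints. A proposition is a closed formula of type $\mathsf{Prop}$; $M\models\varphi$ means that its value at the initial state is $1$. The order of a formula is the largest order of a type in its typing derivation; order-$k$ PHFL consists of the propositions of order at most $k$, and the $\mu^p$-calculus is order-$0$ PHFL. Propositions are equivalent if they have the same semantics over every Markov chain. **Theorem.** Suppose that there are three distinct basic propositions $a,b,c$. Then order-1 PHFL is strictly more expressive than the $\mu^p$-calculus: every $\mu^p$-formula is equivalent to an order-1 PHFL proposition, and there is an order-1 PHFL proposition that is equivalent to no $\mu^p$-formula. The same holds if two propositions are called equivalent as soon as they are satisfied by the same Markov chains. More precisely, let $$\varphi=(\mu F.\lambda X.\,a\land\lozenge(X\lor F(b\land\lozenge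 X)))\,(b\land\lozenge c).$$ This proposition has order $1$. For a nonempty word $w=w_0\cdots w_{n-1}\in\{a,b\}^+$, call $M$ a chain of $w$ if its states are distinct $s_0,\dots,s_n$ with initial state $s_0$, its transitions are $s_i\to s_{i+1}$ ($i<n$) and $s_n\to s_n$, each with probability $1$, and $\rho(a)=\{s_i\mid i<n,\ w_i=a\}$, $\rho(b)=\{s_i\mid i<n,\ w_i=b\}$, $\rho(c)=\{s_n\}$. Then for every chain $M$ of $w$, $$M\models\varphi\iff w\in\{a^mb^m\mid m\ge1\},$$ and this language is not regular. For every $\mu^p$-formula $\psi$ there are a nonempty word $w$ and a chain $M$ of $w$ such that exactly one of $M\models\varphi$ and $M\models\psi$ holds. -/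

import Mathlib

namespace PHFL

universe u

/-! ### Atomic propositions and Markov chains -/

/-- The set of atomic propositions generated by a set `P` of basic propositions: it consists of the
propositions `p` and their formal negations, so it is closed under negation. -/
inductive AP (P : Type u) : Type u
  | pos (p : P) : AP P
  | neg (p : P) : AP P

/-- Finite Markov chains over the atomic propositions `AP P`. The label of a negated proposition is
the complement of the label of the proposition. -/
structure MarkovChain (P : Type u) where
  State : Type
  [fintypeState : Fintype State]
  trans : State → State → unitInterval
  sum_trans : ∀ s, ∑ t, (trans s t : ℝ) = 1
  label : AP P → Set State
  label_neg : ∀ p, label (AP.neg p) = (label (AP.pos p))ᶜ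
  init : State

attribute [instance] MarkovChain.fintypeState

/-! ### Types and formulas -/

/-- Simple types over the type `prop` of quantitative propositions. -/
inductive Ty : Type
  | prop : Ty
  | arr (σ τ : Ty) : Ty

/-- The order of a type. -/
def Ty.order : Ty → ℕ
  | Ty.prop => 0
  | Ty.arr σ τ => max (σ.order + 1) τ.order

/-- The bounds `J` of `[φ]_J`: either `> r` or `≥ r` for a rational number `r ∈ [0, 1]`, where the
trivial bounds `> 1` and `≥ 0` are excluded. -/
inductive Bound : Type
  | gt (r : ℚ) (h0 : 0 ≤ r) (h1 : r < 1) : Bound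
  | ge (r : ℚ) (h0 : 0 < r) (h1 : r ≤ 1) : Bound

/-- The interval that corresponds to a bound. -/
def Bound.toSet : Bound → Set unitInterval
  | Bound.gt r _ _ => {x | (r : ℝ) < x}
  | Bound.ge r _ _ => {x | (r : ℝ) ≤ x}

/-- `Var Γ τ` is the type of variables of type `τ` declared in the type environment `Γ`
(de Bruijn indices). -/
inductive Var : List Ty → Ty → Type
  | zero {Γ : List Ty} {τ : Ty} : Var (τ :: Γ) τ
  | succ {Γ : List Ty} {σ τ : Ty} (x : Var Γ τ) : Var (σ :: Γ) τ

/-- Well-typed PHFL formulas up to renaming of bound variables: an element of `Formula P Γ τ` is a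
formula together with a derivation of the judgment `Γ ⊢ φ : τ`. -/
inductive Formula (P : Type u) : List Ty → Ty → Type u
  | atom {Γ : List Ty} (p : AP P) : Formula P Γ Ty.prop
  | var {Γ : List Ty} {τ : Ty} (x : Var Γ τ) : Formula P Γ τ
  | or {Γ : List Ty} (φ ψ : Formula P Γ Ty.prop) : Formula P Γ Ty.prop
  | and {Γ : List Ty} (φ ψ : Formula P Γ Ty.prop) : Formula P Γ Ty.prop
  | bound {Γ : List Ty} (J : Bound) (φ : Formula P Γ Ty.prop) : Formula P Γ Ty.prop
  | box {Γ : List Ty} (φ : Formula P Γ Ty.prop) : Formula P Γ Ty.prop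
  | dia {Γ : List Ty} (φ : Formula P Γ Ty.prop) : Formula P Γ Ty.prop
  | avg {Γ : List Ty} (φ : Formula P Γ Ty.prop) : Formula P Γ Ty.prop
  | mu {Γ : List Ty} {τ : Ty} (φ : Formula P (τ :: Γ) τ) : Formula P Γ τ
  | nu {Γ : List Ty} {τ : Ty} (φ : Formula P (τ :: Γ) τ) : Formula P Γ τ
  | lam {Γ : List Ty} {σ τ : Ty} (φ : Formula P (σ :: Γ) τ) : Formula P Γ (Ty.arr σ τ)
  | app {Γ : List Ty} {σ τ : Ty} (φ : Formula P Γ (Ty.arr σ τ)) (ψ : Formula P Γ σ) :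
      Formula P Γ τ

/-- The largest order of a type in a judgment `Γ ⊢ _ : τ`. -/
def judgmentOrder : List Ty → Ty → ℕ
  | [], τ => τ.order
  | σ :: Γ, τ => max σ.order (judgmentOrder Γ τ)

/-- The order of a formula: the largest order of the types used in its typing derivation. -/
def Formula.order {P : Type u} : {Γ : List Ty} → {τ : Ty} → Formula P Γ τ → ℕ
  | Γ, _, .atom _ => judgmentOrder Γ Ty.prop
  | Γ, τ, .var _ => judgmentOrder Γ τ
  | Γ, _, .or φ ψ => max (judgmentOrder Γ Ty.prop) (max φ.order ψ.order)
  | Γ, _, .and φ ψ => max (judgmentOrder Γ Ty.prop) (max φ.order ψ.order)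
  | Γ, _, .bound _ φ => max (judgmentOrder Γ Ty.prop) φ.order
  | Γ, _, .box φ => max (judgmentOrder Γ Ty.prop) φ.order
  | Γ, _, .dia φ => max (judgmentOrder Γ Ty.prop) φ.order
  | Γ, _, .avg φ => max (judgmentOrder Γ Ty.prop) φ.order
  | Γ, τ, .mu φ => max (judgmentOrder Γ τ) φ.order
  | Γ, τ, .nu φ => max (judgmentOrder Γ τ) φ.order
  | Γ, _, .lam (σ := σ) (τ := τ) φ => max (judgmentOrder Γ (Ty.arr σ τ)) φ.order
  | Γ, τ, .app φ ψ => max (judgmentOrder Γ τ) (max φ.order ψ.order)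

/-- PHFL propositions: closed formulas of type `prop`. -/
abbrev Proposition (P : Type u) : Type u := Formula P [] Ty.prop

/-- Order-`k` PHFL: the propositions of order at most `k`. -/
def OrderPHFL (P : Type u) (k : ℕ) : Set (Proposition P) := {φ | φ.order ≤ k}

/-- The `μᵖ`-calculus is order-0 PHFL: the propositions built, without abstraction and application,
from atomic propositions, variables of type `prop`, `∨`, `∧`, `[_]_J`, `□`, `◇`, averages and least
and greatest fixpoints of type `prop`. -/
def MuP (P : Type u) : Set (Proposition P) := OrderPHFL P 0

/-! ### Semantics -/

/-- The semantics of types over a state space `S`: functions `S → [0, 1]` for `prop`, monotone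
functions for arrow types, both ordered pointwise. Carrier and order are defined together. -/
noncomputable def TyLattice (S : Type) : Ty → (D : Type) × CompleteLattice D
  | Ty.prop => ⟨S → unitInterval, inferInstance⟩
  | Ty.arr σ τ =>
      letI := (TyLattice S σ).2
      letI := (TyLattice S τ).2
      ⟨(TyLattice S σ).1 →o (TyLattice S τ).1, inferInstance⟩

/-- The carrier of the semantics of a type. -/
def Dom (S : Type) (τ : Ty) : Type := (TyLattice S τ).1

/-- The semantics of a type is a complete lattice. -/
noncomputable instance instCompleteLatticeDom (S : Type) (τ : Ty) : CompleteLattice (Dom S τ) :=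
  (TyLattice S τ).2

/-- An element of the semantics of an arrow type is a monotone function. -/
def Dom.toHom {S : Type} {σ τ : Ty} (f : Dom S (Ty.arr σ τ)) : Dom S σ →o Dom S τ := f

/-- A monotone function is an element of the semantics of an arrow type. -/
def Dom.ofHom {S : Type} {σ τ : Ty} (f : Dom S σ →o Dom S τ) : Dom S (Ty.arr σ τ) := f

/-- Valuations of a type environment, ordered componentwise. -/
def Env (S : Type) : List Ty → Type
  | [] => Unit
  | τ :: Γ => Dom S τ × Env S Γ

/-- The empty valuation. -/
def Env.nil {S : Type} : Env S [] := ()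

/-- Extension of a valuation by a value for the most recently declared variable. -/
def Env.cons {S : Type} {Γ : List Ty} {τ : Ty} (v : Dom S τ) (ρ : Env S Γ) : Env S (τ :: Γ) :=
  (v, ρ)

/-- The componentwise order on valuations. -/
noncomputable instance instPreorderEnv (S : Type) : (Γ : List Ty) → Preorder (Env S Γ)
  | [] => inferInstanceAs (Preorder Unit)
  | τ :: Γ =>
      letI := instPreorderEnv S Γ
      inferInstanceAs (Preorder (Dom S τ × Env S Γ))

/-- The value of a variable, as a monotone function of the valuation. -/
noncomputable def Var.sem (S : Type) : {Γ : List Ty} → {τ : Ty} → Var Γ τ → (Env S Γ →o Dom S τ)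
  | _, _, .zero => ⟨fun ρ => ρ.1, fun _ _ h => h.1⟩
  | _, _, .succ x => ⟨fun ρ => x.sem S ρ.2, fun _ _ h => (x.sem S).monotone h.2⟩

/-- The value of an atomic proposition. -/
noncomputable def atomSem {P : Type u} (M : MarkovChain P) (p : AP P) : M.State → unitInterval :=
  open Classical in fun s => if s ∈ M.label p then 1 else 0

/-- The value of `[φ]_J`. -/
noncomputable def boundSem {S : Type} (J : Bound) (f : S → unitInterval) : S → unitInterval :=
  open Classical in fun s => if f s ∈ J.toSet then 1 else 0

/-- The minimum over the successors (which form a finite nonempty set). -/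
noncomputable def boxSem {P : Type u} (M : MarkovChain P) (f : M.State → unitInterval) :
    M.State → unitInterval :=
  fun s => ⨅ t : {t : M.State // 0 < M.trans s t}, f t

/-- The maximum over the successors (which form a finite nonempty set). -/
noncomputable def diaSem {P : Type u} (M : MarkovChain P) (f : M.State → unitInterval) :
    M.State → unitInterval :=
  fun s => ⨆ t : {t : M.State // 0 < M.trans s t}, f t

/-- The average over the successors. -/
noncomputable def avgSem {P : Type u} (M : MarkovChain P) (f : M.State → unitInterval) :
    M.State → unitInterval :=
  fun s => ⟨∑ t, (M.trans s t : ℝ) * (f t : ℝ),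
    Finset.sum_nonneg fun t _ => mul_nonneg (M.trans s t).2.1 (f t).2.1,
    (Finset.sum_le_sum fun t _ =>
      mul_le_of_le_one_right (M.trans s t).2.1 (f t).2.2).trans (M.sum_trans s).le⟩

theorem boundSem_mono {S : Type} (J : Bound) : Monotone (boundSem (S := S) J) := by
  intro f g h s
  have hs : (f s : ℝ) ≤ g s := h s
  unfold boundSem
  split_ifs with h1 h2
  · exact le_rfl
  · exfalso
    apply h2
    cases J with
    | gt r h0 h1r => exact lt_of_lt_of_le (show (r : ℝ) < f s from h1) hs
    | ge r h0 h1r => exact le_trans (show (r : ℝ) ≤ f s from h1) hs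
  · exact bot_le
  · exact le_rfl

theorem boxSem_mono {P : Type u} (M : MarkovChain P) : Monotone (boxSem M) :=
  fun _ _ h _ => iInf_mono fun t => h t

theorem diaSem_mono {P : Type u} (M : MarkovChain P) : Monotone (diaSem M) :=
  fun _ _ h _ => iSup_mono fun t => h t

theorem avgSem_mono {P : Type u} (M : MarkovChain P) : Monotone (avgSem M) := by
  intro f g h s
  have key : ∑ t, (M.trans s t : ℝ) * (f t : ℝ) ≤ ∑ t, (M.trans s t : ℝ) * (g t : ℝ) :=
    Finset.sum_le_sum fun t _ => mul_le_mul_of_nonneg_left (h t) (M.trans s t).2.1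
  exact key

/-- Regard a monotone operation on `S → [0, 1]` as an operation on the semantics of `prop`. -/
noncomputable def liftProp {S : Type} (F : (S → unitInterval) → (S → unitInterval))
    (hF : Monotone F) : Dom S Ty.prop →o Dom S Ty.prop :=
  ⟨F, hF⟩

/-- The semantics of formulas over a Markov chain, as a monotone function of the valuation. -/
noncomputable def Formula.sem {P : Type u} (M : MarkovChain P) :
    {Γ : List Ty} → {τ : Ty} → Formula P Γ τ → (Env M.State Γ →o Dom M.State τ)
  | _, _, .atom p => ⟨fun _ => atomSem M p, fun _ _ _ => le_rfl⟩
  | _, _, .var x => x.sem M.State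
  | _, _, .or φ ψ => φ.sem M ⊔ ψ.sem M
  | _, _, .and φ ψ => φ.sem M ⊓ ψ.sem M
  | _, _, .bound J φ => (liftProp (boundSem J) (boundSem_mono J)).comp (φ.sem M)
  | _, _, .box φ => (liftProp (boxSem M) (boxSem_mono M)).comp (φ.sem M)
  | _, _, .dia φ => (liftProp (diaSem M) (diaSem_mono M)).comp (φ.sem M)
  | _, _, .avg φ => (liftProp (avgSem M) (avgSem_mono M)).comp (φ.sem M)
  | _, _, .mu φ =>
      ⟨fun ρ => OrderHom.lfp ⟨fun v => φ.sem M (Env.cons v ρ),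
          fun _ _ h => (φ.sem M).monotone ⟨h, le_rfl⟩⟩,
        fun _ _ h => OrderHom.lfp.monotone fun _ => (φ.sem M).monotone ⟨le_rfl, h⟩⟩
  | _, _, .nu φ =>
      ⟨fun ρ => OrderHom.gfp ⟨fun v => φ.sem M (Env.cons v ρ),
          fun _ _ h => (φ.sem M).monotone ⟨h, le_rfl⟩⟩,
        fun _ _ h => OrderHom.gfp.monotone fun _ => (φ.sem M).monotone ⟨le_rfl, h⟩⟩
  | _, _, .lam φ =>
      ⟨fun ρ => Dom.ofHom ⟨fun v => φ.sem M (Env.cons v ρ),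
          fun _ _ h => (φ.sem M).monotone ⟨h, le_rfl⟩⟩,
        fun _ _ h => fun _ => (φ.sem M).monotone ⟨le_rfl, h⟩⟩
  | _, _, .app φ ψ =>
      ⟨fun ρ => (φ.sem M ρ).toHom (ψ.sem M ρ),
        fun _ ρ' h => le_trans ((φ.sem M _).toHom.monotone ((ψ.sem M).monotone h))
          ((φ.sem M).monotone h (ψ.sem M ρ'))⟩

/-- The value of a proposition at the states of a Markov chain. -/
noncomputable def Formula.value {P : Type u} (φ : Proposition P) (M : MarkovChain P) :
    M.State → unitInterval :=
  φ.sem M Env.nil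

/-- `M ⊨ φ`: the value of `φ` at the initial state is 1. -/
def MarkovChain.Models {P : Type u} (M : MarkovChain P) (φ : Proposition P) : Prop :=
  φ.value M M.init = 1

/-! ### Expressive power -/

/-- Two propositions are equivalent if they have the same semantics over every Markov chain. -/
def Equivalent {P : Type u} (φ ψ : Proposition P) : Prop :=
  ∀ M : MarkovChain P, φ.value M = ψ.value M

/-- Two propositions are satisfied by the same Markov chains. -/
def SameModels {P : Type u} (φ ψ : Proposition P) : Prop :=
  ∀ M : MarkovChain P, M.Models φ ↔ M.Models ψ

/-- Every proposition of `G` is equivalent to one of `F`, for a notion `R` of equivalence. -/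
def AtLeastAsExpressive {P : Type u} (R : Proposition P → Proposition P → Prop)
    (F G : Set (Proposition P)) : Prop :=
  ∀ ψ ∈ G, ∃ φ ∈ F, R φ ψ

/-- `F` is strictly more expressive than `G`, for a notion `R` of equivalence. -/
def StrictlyMoreExpressive {P : Type u} (R : Proposition P → Proposition P → Prop)
    (F G : Set (Proposition P)) : Prop :=
  AtLeastAsExpressive R F G ∧ ∃ φ ∈ F, ∀ ψ ∈ G, ¬ R φ ψ

/-- The proposition `(μF. λX. a ∧ ◇(X ∨ F (b ∧ ◇X))) (b ∧ ◇c)`. -/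
def witness {P : Type u} (a b c : P) : Proposition P :=
  .app
    (.mu (τ := Ty.arr Ty.prop Ty.prop) (.lam
      (.and (.atom (AP.pos a))
        (.dia (.or (.var Var.zero)
          (.app (.var (Var.succ Var.zero))
            (.and (.atom (AP.pos b)) (.dia (.var Var.zero)))))))))
    (.and (.atom (AP.pos b)) (.dia (.atom (AP.pos c))))

/-- The alphabet with two letters. -/
inductive Letter : Type
  | a : Letter
  | b : Letter

/-- `M` is the deterministic chain of a nonempty word `w` of length `n`: its states are
`s 0, …, s n`, it starts in `s 0`, moves from `s i` to `s (i + 1)` for `i < n` and stays in `s n`;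
among the states `s i` with `i < n`, those with `wᵢ = a` form the label of `a` and those
with `wᵢ = b` that of `b`; the label of `c` is `{s n}`. Other labels are arbitrary. -/
structure IsWordChain {P : Type u} (a b c : P) (w : List Letter) (M : MarkovChain P)
    (s : Fin (w.length + 1) ≃ M.State) : Prop where
  ne_nil : w ≠ []
  trans_eq : ∀ i j, M.trans (s i) (s j) = if (j : ℕ) = min ((i : ℕ) + 1) w.length then 1 else 0
  label_a : M.label (AP.pos a) = {x | ∃ i, x = s i ∧ w[(i : ℕ)]? = some Letter.a}
  label_b : M.label (AP.pos b) = {x | ∃ i, x = s i ∧ w[(i : ℕ)]? = some Letter.b}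
  label_c : M.label (AP.pos c) = {s (Fin.last w.length)}
  init_eq : M.init = s 0

/-- The language `{aᵐbᵐ | m ≥ 1}`. -/
def anbn : Language Letter :=
  {w | ∃ m, 1 ≤ m ∧ w = List.replicate m Letter.a ++ List.replicate m Letter.b}

end PHFL

/-!
The proof restricts attention to the chains of words, on which everything is deterministic.

Index the states of such a chain by their distance from the end (`IsCountdown`). Each of the three
modalities then takes the value at the next position, `[_]_J` does not change a value in `{0, 1}`,
and formulas of order 0 take values in `{0, 1}` only. The value of such a formula at a position
depends on this and the later positions only, so a fixpoint can be computed from the end of the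
chain backwards: once the values at the later positions are known, the value at the present position
is the least or greatest fixpoint of a monotone map on two truth values, which is found in one step
from below or above (`IsCountdown.lfp_eq_indFun`, `IsCountdown.gfp_eq_indFun`). By induction on the
formula, this backward computation is done by a finite automaton that reads the labels of the states
(`exists_isRegular_defines`; `fixDFA` is the automaton of a fixpoint formula). Hence a formula of
order 0 defines a regular language of words.

The witness, on the other hand, defines `{aᵐbᵐ | m ≥ 1}`: the fixpoint equation of its recursive
function determines the values of this function at all arguments `b ∧ ◇(b ∧ ◇(⋯ c))`, again
backwards from the end (`IsWordChain.witnessFun_eq`). This language is not regular, as the words `aᵐ`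
have distinct left quotients (`not_isRegular_anbn`), so every formula of order 0 differs from
the witness on the chain of some word.
-/

namespace PHFL

universe u

/-! ### Formulas of order 0 -/

theorem Ty.order_le_judgmentOrder (Γ : List Ty) (τ : Ty) : τ.order ≤ judgmentOrder Γ τ := by
  induction Γ with
  | nil => exact le_rfl
  | cons σ Γ ih => exact ih.trans (le_max_right _ _)

theorem Formula.judgmentOrder_le_order {P : Type u} {Γ : List Ty} {τ : Ty} (φ : Formula P Γ τ) :
    judgmentOrder Γ τ ≤ φ.order := by
  cases φ <;> simp [Formula.order]

theorem Formula.order_app_ne_zero {P : Type u} {Γ : List Ty} {σ τ : Ty}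
    (φ : Formula P Γ (Ty.arr σ τ)) (ψ : Formula P Γ σ) : (φ.app ψ).order ≠ 0 := by
  have h1 := (Ty.order_le_judgmentOrder Γ (Ty.arr σ τ)).trans φ.judgmentOrder_le_order
  simp only [Formula.order, Ty.order] at h1 ⊢
  omega

/-! ### Deterministic chains indexed by the distance from the end -/

/-- The value `1` if `q` holds and `0` otherwise. -/
noncomputable def ind (q : Prop) : unitInterval :=
  open Classical in if q then 1 else 0

@[simp] theorem ind_eq_one {q : Prop} : ind q = 1 ↔ q := by
  unfold ind; split_ifs with h <;> simp [h]

theorem ind_of {q : Prop} (h : q) : ind q = 1 := ind_eq_one.2 h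

theorem ind_of_not {q : Prop} (h : ¬ q) : ind q = 0 := if_neg h

theorem ind_or (p q : Prop) : ind (p ∨ q) = ind p ⊔ ind q := by
  by_cases hp : p <;> by_cases hq : q <;> simp [ind, hp, hq]

theorem ind_and (p q : Prop) : ind (p ∧ q) = ind p ⊓ ind q := by
  by_cases hp : p <;> by_cases hq : q <;> simp [ind, hp, hq]

/-- Every admissible bound is satisfied by `1` and not by `0`: the bounds `> 1` and `≥ 0` are
excluded. -/
theorem boundSem_of_eq_ind {S : Type} (J : Bound) (f : S → unitInterval) {s : S} {q : Prop}
    (h : f s = ind q) : boundSem J f s = ind q := by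
  by_cases hq : q
  · rw [ind_of hq] at h ⊢
    refine if_pos ?_
    rw [h]
    cases J with
    | gt r h0 h1 => exact (by exact_mod_cast h1 : (r : ℝ) < 1)
    | ge r h0 h1 => exact (by exact_mod_cast h1 : (r : ℝ) ≤ 1)
  · rw [ind_of_not hq] at h ⊢
    refine if_neg ?_
    rw [h]
    cases J with
    | gt r h0 h1 => exact not_lt.2 (by exact_mod_cast h0 : (0 : ℝ) ≤ r)
    | ge r h0 h1 => exact not_le.2 (by exact_mod_cast h0 : (0 : ℝ) < r)

/-- `M` is deterministic with the distinct states `t n, t (n - 1), …, t 0`, passed in this order,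
and stays in `t 0`; thus `t k` has distance `k` from the end. The values `t k` for `k > n` are
irrelevant, and `k - 1` is truncated, which accounts for the loop at `t 0`. -/
structure IsCountdown {P : Type u} (M : MarkovChain P) (n : ℕ) (t : ℕ → M.State) : Prop where
  surj : ∀ s, ∃ k ≤ n, t k = s
  inj : ∀ j ≤ n, ∀ k ≤ n, t j = t k → j = k
  trans_self : ∀ k ≤ n, M.trans (t k) (t (k - 1)) = 1
  trans_of_ne : ∀ k ≤ n, ∀ s, s ≠ t (k - 1) → M.trans (t k) s = 0

section Countdown

variable {P : Type u} {M : MarkovChain P} {n : ℕ} {t : ℕ → M.State}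

theorem IsCountdown.trans_pos_iff (ht : IsCountdown M n t) {k : ℕ} (hk : k ≤ n) (s : M.State) :
    0 < M.trans (t k) s ↔ s = t (k - 1) := by
  constructor
  · intro h
    by_contra hs
    rw [ht.trans_of_ne k hk s hs] at h
    exact lt_irrefl _ h
  · rintro rfl
    rw [ht.trans_self k hk]
    exact zero_lt_one

theorem IsCountdown.boxSem_eq (ht : IsCountdown M n t) {k : ℕ} (hk : k ≤ n)
    (f : M.State → unitInterval) : boxSem M f (t k) = f (t (k - 1)) := by
  refine le_antisymm (iInf_le_of_le ⟨_, (ht.trans_pos_iff hk _).2 rfl⟩ le_rfl) (le_iInf ?_)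
  rintro ⟨s, hs⟩
  exact (congrArg f ((ht.trans_pos_iff hk s).1 hs)).ge

theorem IsCountdown.diaSem_eq (ht : IsCountdown M n t) {k : ℕ} (hk : k ≤ n)
    (f : M.State → unitInterval) : diaSem M f (t k) = f (t (k - 1)) := by
  refine le_antisymm (iSup_le ?_) (le_iSup_of_le ⟨_, (ht.trans_pos_iff hk _).2 rfl⟩ le_rfl)
  rintro ⟨s, hs⟩
  exact (congrArg f ((ht.trans_pos_iff hk s).1 hs)).le

theorem IsCountdown.avgSem_eq (ht : IsCountdown M n t) {k : ℕ} (hk : k ≤ n)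
    (f : M.State → unitInterval) : avgSem M f (t k) = f (t (k - 1)) := by
  apply Subtype.ext
  change ∑ s, (M.trans (t k) s : ℝ) * (f s : ℝ) = _
  rw [Fintype.sum_eq_single (t (k - 1))]
  · rw [ht.trans_self k hk]; simp
  · intro s hs
    rw [ht.trans_of_ne k hk s hs]; simp

/-- The `{0, 1}`-valued function on the states that is given by a predicate on the positions. -/
noncomputable def indFun (n : ℕ) (t : ℕ → M.State) (v : ℕ → Prop) : Dom M.State Ty.prop :=
  fun s => ind (∃ k ≤ n, t k = s ∧ v k)

theorem IsCountdown.indFun_apply (ht : IsCountdown M n t) (v : ℕ → Prop) {k : ℕ} (hk : k ≤ n) :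
    indFun n t v (t k) = ind (v k) := by
  refine congrArg ind (propext ⟨?_, fun h => ⟨k, hk, rfl, h⟩⟩)
  rintro ⟨j, hj, hjk, h⟩
  rwa [← ht.inj j hj k hk hjk]

/-- A criterion for least fixpoints over a chain. If the value of `F` at a position depends on its
argument at this and the later positions only, then a least fixpoint can be computed backwards from
the end, position by position: its value is that of `F` with the value `0` plugged in at the present
position. -/
theorem IsCountdown.lfp_eq_indFun (ht : IsCountdown M n t)
    (F : Dom M.State Ty.prop →o Dom M.State Ty.prop) (v : ℕ → Prop)
    (hF : ∀ k ≤ n, F (indFun n t fun j => v j ∧ j < k) (t k) = ind (v k))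
    (hF' : ∀ k ≤ n, ¬ v k → F (indFun n t v) (t k) = 0) :
    OrderHom.lfp F = indFun n t v := by
  apply le_antisymm
  · refine OrderHom.lfp_le F fun s => ?_
    obtain ⟨k, hk, rfl⟩ := ht.surj s
    by_cases hv : v k
    · rw [ht.indFun_apply v hk, ind_of hv]
      exact le_top
    · rw [hF' k hk hv]
      exact bot_le
  · refine OrderHom.le_lfp F fun u hu => ?_
    -- The truncation of `v` at position `k` is below `u` by the induction hypothesis.
    have key : ∀ k, k ≤ n → ind (v k) ≤ u (t k) := by
      intro k
      induction k using Nat.strong_induction_on with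
      | _ k ih =>
        intro hk
        rw [← hF k hk]
        refine le_trans (F.monotone (b := u) (fun s => ?_) (t k)) (hu (t k))
        obtain ⟨j, hj, rfl⟩ := ht.surj s
        rw [ht.indFun_apply _ hj, ind_and]
        by_cases hjk : j < k
        · exact inf_le_left.trans (ih j hjk hj)
        · rw [ind_of_not hjk]
          exact inf_le_right.trans bot_le
    intro s
    obtain ⟨k, hk, rfl⟩ := ht.surj s
    rw [ht.indFun_apply v hk]
    exact key k hk

/-- The dual of `IsCountdown.lfp_eq_indFun`, with the value `1` plugged in. -/
theorem IsCountdown.gfp_eq_indFun (ht : IsCountdown M n t)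
    (F : Dom M.State Ty.prop →o Dom M.State Ty.prop) (v : ℕ → Prop)
    (hF : ∀ k ≤ n, F (indFun n t fun j => j < k → v j) (t k) = ind (v k))
    (hF' : ∀ k ≤ n, v k → F (indFun n t v) (t k) = 1) :
    OrderHom.gfp F = indFun n t v := by
  apply le_antisymm
  · refine OrderHom.gfp_le F fun u hu => ?_
    have key : ∀ k, k ≤ n → u (t k) ≤ ind (v k) := by
      intro k
      induction k using Nat.strong_induction_on with
      | _ k ih =>
        intro hk
        rw [← hF k hk]
        refine le_trans (hu (t k)) (F.monotone (a := u) (fun s => ?_) (t k))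
        obtain ⟨j, hj, rfl⟩ := ht.surj s
        rw [ht.indFun_apply _ hj]
        by_cases hjk : j < k
        · exact (ih j hjk hj).trans_eq (congrArg ind (propext ⟨fun h _ => h, fun h => h hjk⟩))
        · rw [ind_of fun h => absurd h hjk]
          exact le_top
    intro s
    obtain ⟨k, hk, rfl⟩ := ht.surj s
    rw [ht.indFun_apply v hk]
    exact key k hk
  · refine OrderHom.le_gfp F fun s => ?_
    obtain ⟨k, hk, rfl⟩ := ht.surj s
    by_cases hv : v k
    · rw [hF' k hk hv]
      exact le_top
    · rw [ht.indFun_apply v hk, ind_of_not hv]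
      exact bot_le

end Countdown

/-! ### Order-0 formulas over chains define regular languages -/

/-- The information about a state that the value of a formula depends on: the atomic propositions
and the variables that hold there. -/
abbrev LocalInfo (P : Type u) (Γ : List Ty) : Type u := Set (AP P) × Set (Var Γ Ty.prop)

/-- The word that is read when a chain is traversed from its end `t 0` to the state before position
`k`, where `e` says which variables hold at each position. -/
def backTrace {P : Type u} {M : MarkovChain P} {Γ : List Ty} (t : ℕ → M.State)
    (e : ℕ → Set (Var Γ Ty.prop)) (k : ℕ) : List (LocalInfo P Γ) :=
  (List.range k).map fun j => ({p | t j ∈ M.label p}, e j)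

theorem backTrace_succ {P : Type u} {M : MarkovChain P} {Γ : List Ty} (t : ℕ → M.State)
    (e : ℕ → Set (Var Γ Ty.prop)) (k : ℕ) :
    backTrace t e (k + 1) = backTrace t e k ++ [({p | t k ∈ M.label p}, e k)] := by
  simp [backTrace, List.range_succ]

/-- The valuation `ρ` gives to every variable of type `prop` the value `0` or `1` at every position,
as described by `e`. -/
def Represents {P : Type u} {M : MarkovChain P} {Γ : List Ty} (n : ℕ) (t : ℕ → M.State)
    (ρ : Env M.State Γ) (e : ℕ → Set (Var Γ Ty.prop)) : Prop :=
  ∀ k ≤ n, ∀ x : Var Γ Ty.prop, (x.sem M.State ρ : M.State → unitInterval) (t k) = ind (x ∈ e k)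

/-- Over all chains and all `{0, 1}`-valued valuations, `φ` has the value `1` at position `k` if the
traversal from the end up to and including this position is in `L`, and the value `0` otherwise. -/
def Defines {P : Type u} {Γ : List Ty} (φ : Formula P Γ Ty.prop) (L : Language (LocalInfo P Γ)) :
    Prop :=
  ∀ (M : MarkovChain P) (n : ℕ) (t : ℕ → M.State), IsCountdown M n t →
    ∀ (ρ : Env M.State Γ) (e : ℕ → Set (Var Γ Ty.prop)), Represents n t ρ e →
      ∀ k ≤ n, (φ.sem M ρ : M.State → unitInterval) (t k) = ind (backTrace t e (k + 1) ∈ L)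

section Closure

variable {P : Type u} {Γ : List Ty} {α : Type*}

/-- The automaton that accepts the nonempty words whose last letter is in `A`. -/
def lastDFA (A : Set α) : DFA α Prop where
  step _ x := x ∈ A
  start := False
  accept := {q | q}

theorem isRegular_lastDFA (A : Set α) : (lastDFA A).accepts.IsRegular :=
  ⟨Prop, inferInstance, lastDFA A, rfl⟩

theorem append_singleton_mem_lastDFA (A : Set α) (l : List α) (x : α) :
    l ++ [x] ∈ (lastDFA A).accepts ↔ x ∈ A := by
  rw [DFA.mem_accepts, DFA.eval_append_singleton]
  rfl

theorem defines_atom (p : AP P) :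
    Defines (Formula.atom (Γ := Γ) p) (lastDFA {x : LocalInfo P Γ | p ∈ x.1}).accepts := by
  intro M n t ht ρ e he k hk
  rw [backTrace_succ, append_singleton_mem_lastDFA]
  rfl

theorem defines_var (x : Var Γ Ty.prop) :
    Defines (Formula.var (P := P) x) (lastDFA {y : LocalInfo P Γ | x ∈ y.2}).accepts := by
  intro M n t ht ρ e he k hk
  rw [backTrace_succ, append_singleton_mem_lastDFA]
  exact he k hk x

/-- Runs `D`, and remembers if `D` accepted before the last letter was read; after the first letter,
which stands for the looping state at the end of a chain, it remembers if `D` accepts now. -/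
def delayDFA {σ : Type*} (D : DFA α σ) : DFA α (Option (σ × Prop)) where
  step q x := match q with
    | none => some (D.step D.start x, D.step D.start x ∈ D.accept)
    | some q => some (D.step q.1 x, q.1 ∈ D.accept)
  start := none
  accept := {q | ∃ r, q = some r ∧ r.2}

theorem eval_delayDFA_map_range {σ : Type*} (D : DFA α σ) (x : ℕ → α) (k : ℕ) :
    (delayDFA D).eval ((List.range (k + 1)).map x) =
      some (D.eval ((List.range (k + 1)).map x),
        D.eval ((List.range (k - 1 + 1)).map x) ∈ D.accept) := by
  induction k with
  | zero => rfl
  | succ k ih =>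
    rw [List.range_succ, List.map_append, List.map_singleton, DFA.eval_append_singleton, ih,
      DFA.eval_append_singleton]
    rfl

theorem map_range_mem_delayDFA {σ : Type*} (D : DFA α σ) (x : ℕ → α) (k : ℕ) :
    (List.range (k + 1)).map x ∈ (delayDFA D).accepts ↔
      (List.range (k - 1 + 1)).map x ∈ D.accepts := by
  rw [DFA.mem_accepts, eval_delayDFA_map_range]
  constructor
  · rintro ⟨r, hr, h⟩
    obtain rfl := Option.some.inj hr
    exact h
  · exact fun h => ⟨_, rfl, h⟩

/-- Each of the three modalities takes the value at the next position. -/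
theorem Defines.delay {φ ψ : Formula P Γ Ty.prop} {L : Language (LocalInfo P Γ)}
    (hL : L.IsRegular) (hφ : Defines φ L)
    (h : ∀ (M : MarkovChain P) (n : ℕ) (t : ℕ → M.State), IsCountdown M n t →
      ∀ (ρ : Env M.State Γ), ∀ k ≤ n, (ψ.sem M ρ : M.State → unitInterval) (t k) =
        (φ.sem M ρ : M.State → unitInterval) (t (k - 1))) :
    ∃ L' : Language (LocalInfo P Γ), L'.IsRegular ∧ Defines ψ L' := by
  obtain ⟨σ, hσ, D, rfl⟩ := hL
  refine ⟨(delayDFA D).accepts, ⟨Option (σ × Prop), inferInstance, delayDFA D, rfl⟩, ?_⟩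
  intro M n t ht ρ e he k hk
  rw [h M n t ht ρ k hk, hφ M n t ht ρ e he (k - 1) (by omega)]
  exact congrArg ind (propext (map_range_mem_delayDFA D _ k).symm)

/-- The variables that hold after a variable has been declared, which holds if `q`. -/
def consVars (q : Prop) (g : Set (Var Γ Ty.prop)) : Set (Var (Ty.prop :: Γ) Ty.prop) :=
  fun x => match x with
    | .zero => q
    | .succ y => y ∈ g

/-- From an automaton `D` for the body of a fixpoint formula, an automaton for the formula. At each
position, the state that `D` has reached accounts for the values at the later positions. It remains
to find the least (`q = False`) or greatest (`q = True`) fixpoint of a monotone operation on the two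
truth values, which is the value of this operation at `q`. -/
def fixDFA {σ : Type*} (q : Prop) (D : DFA (LocalInfo P (Ty.prop :: Γ)) σ) :
    DFA (LocalInfo P Γ) σ where
  step r x := D.step r (x.1, consVars (D.step r (x.1, consVars q x.2) ∈ D.accept) x.2)
  start := D.start
  accept := D.accept

/-- The value of the fixpoint formula at position `k` that is found by `fixDFA q D`. -/
def fixVal {M : MarkovChain P} {σ : Type*} (q : Prop) (D : DFA (LocalInfo P (Ty.prop :: Γ)) σ)
    (t : ℕ → M.State) (e : ℕ → Set (Var Γ Ty.prop)) (k : ℕ) : Prop :=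
  D.step ((fixDFA q D).eval (backTrace t e k)) ({p | t k ∈ M.label p}, consVars q (e k)) ∈ D.accept

theorem eval_fixDFA {M : MarkovChain P} {σ : Type*} (q : Prop)
    (D : DFA (LocalInfo P (Ty.prop :: Γ)) σ) (t : ℕ → M.State) (e : ℕ → Set (Var Γ Ty.prop))
    (k : ℕ) :
    (fixDFA q D).eval (backTrace t e k) =
      D.eval (backTrace t (fun j => consVars (fixVal q D t e j) (e j)) k) := by
  induction k with
  | zero => rfl
  | succ k ih =>
    rw [backTrace_succ, backTrace_succ, DFA.eval_append_singleton, DFA.eval_append_singleton, ← ih]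
    rfl

theorem backTrace_congr {M : MarkovChain P} {t : ℕ → M.State} {e e' : ℕ → Set (Var Γ Ty.prop)}
    {k : ℕ} (h : ∀ j < k, e j = e' j) : backTrace t e k = backTrace t e' k := by
  refine List.map_congr_left fun j hj => ?_
  rw [h j (List.mem_range.1 hj)]

/-- If the variable has the value found by `fixDFA q D` at the later positions and the value `q` at
position `k`, then `D` finds the value of `fixDFA q D` at position `k`. -/
theorem mem_accepts_iff_fixVal {M : MarkovChain P} {σ : Type*} {q : Prop}
    {D : DFA (LocalInfo P (Ty.prop :: Γ)) σ} {t : ℕ → M.State} {e : ℕ → Set (Var Γ Ty.prop)}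
    {k : ℕ} {v : ℕ → Prop} (hlt : ∀ j < k, (v j ↔ fixVal q D t e j)) (hk : v k ↔ q) :
    backTrace t (fun j => consVars (v j) (e j)) (k + 1) ∈ D.accepts ↔ fixVal q D t e k := by
  rw [DFA.mem_accepts, backTrace_succ, DFA.eval_append_singleton, propext hk, fixVal, eval_fixDFA,
    backTrace_congr fun j hj => by rw [propext (hlt j hj)]]

theorem Represents.cons {M : MarkovChain P} {n : ℕ} {t : ℕ → M.State} (ht : IsCountdown M n t)
    {ρ : Env M.State Γ} {e : ℕ → Set (Var Γ Ty.prop)} (h : Represents n t ρ e) (v : ℕ → Prop) :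
    Represents n t (Env.cons (indFun n t v) ρ) fun k => consVars (v k) (e k) := by
  intro k hk x
  cases x with
  | zero => exact ht.indFun_apply v hk
  | succ y => exact h k hk y

theorem backTrace_mem_fixDFA {M : MarkovChain P} {σ : Type*} {q : Prop}
    {D : DFA (LocalInfo P (Ty.prop :: Γ)) σ} {t : ℕ → M.State} {e : ℕ → Set (Var Γ Ty.prop)}
    {k : ℕ} : backTrace t e k ∈ (fixDFA q D).accepts ↔
      backTrace t (fun j => consVars (fixVal q D t e j) (e j)) k ∈ D.accepts := by
  rw [DFA.mem_accepts, DFA.mem_accepts, eval_fixDFA]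
  rfl

theorem Defines.mu {φ : Formula P (Ty.prop :: Γ) Ty.prop} {σ : Type*}
    {D : DFA (LocalInfo P (Ty.prop :: Γ)) σ} (hφ : Defines φ D.accepts) :
    Defines φ.mu (fixDFA False D).accepts := by
  intro M n t ht ρ e he k hk
  let F : Dom M.State Ty.prop →o Dom M.State Ty.prop :=
    ⟨fun v => φ.sem M (Env.cons v ρ), fun _ _ h => (φ.sem M).monotone ⟨h, le_rfl⟩⟩
  let v := fixVal False D t e
  have hF : ∀ v' : ℕ → Prop, ∀ k ≤ n, F (indFun n t v') (t k) =
      ind (backTrace t (fun j => consVars (v' j) (e j)) (k + 1) ∈ D.accepts) :=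
    fun v' => hφ M n t ht _ _ (he.cons ht v')
  have hfix : OrderHom.lfp F = indFun n t v := by
    apply ht.lfp_eq_indFun
    · intro k hk
      rw [hF _ k hk, mem_accepts_iff_fixVal (q := False) (fun j hj => by simp [v, hj]) (by simp)]
    · intro k hk hv
      rw [hF _ k hk, mem_accepts_iff_fixVal (fun j _ => Iff.rfl) (iff_false_intro hv)]
      exact ind_of_not hv
  -- One unfolding of the fixpoint turns it into a value of `F`, which `D` computes.
  change OrderHom.lfp F (t k) = _
  rw [← OrderHom.map_lfp F, hfix, hF _ k hk, backTrace_mem_fixDFA]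

theorem Defines.nu {φ : Formula P (Ty.prop :: Γ) Ty.prop} {σ : Type*}
    {D : DFA (LocalInfo P (Ty.prop :: Γ)) σ} (hφ : Defines φ D.accepts) :
    Defines φ.nu (fixDFA True D).accepts := by
  intro M n t ht ρ e he k hk
  let F : Dom M.State Ty.prop →o Dom M.State Ty.prop :=
    ⟨fun v => φ.sem M (Env.cons v ρ), fun _ _ h => (φ.sem M).monotone ⟨h, le_rfl⟩⟩
  let v := fixVal True D t e
  have hF : ∀ v' : ℕ → Prop, ∀ k ≤ n, F (indFun n t v') (t k) =
      ind (backTrace t (fun j => consVars (v' j) (e j)) (k + 1) ∈ D.accepts) :=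
    fun v' => hφ M n t ht _ _ (he.cons ht v')
  have hfix : OrderHom.gfp F = indFun n t v := by
    apply ht.gfp_eq_indFun
    · intro k hk
      rw [hF _ k hk, mem_accepts_iff_fixVal (q := True) (fun j hj => by simp [v, hj]) (by simp)]
    · intro k hk hv
      rw [hF _ k hk, mem_accepts_iff_fixVal (fun j _ => Iff.rfl) (iff_true_intro hv)]
      exact ind_of hv
  change OrderHom.gfp F (t k) = _
  rw [← OrderHom.map_gfp F, hfix, hF _ k hk, backTrace_mem_fixDFA]

end Closure

/-- A formula of order 0 contains no abstraction and no application, and all its fixpoints are of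
type `prop`. -/
theorem exists_isRegular_defines {P : Type u} : ∀ {Γ : List Ty} (φ : Formula P Γ Ty.prop),
    φ.order = 0 → ∃ L : Language (LocalInfo P Γ), L.IsRegular ∧ Defines φ L
  | _, .atom p, _ => ⟨_, isRegular_lastDFA _, defines_atom p⟩
  | _, .var x, _ => ⟨_, isRegular_lastDFA _, defines_var x⟩
  | _, .or φ ψ, h => by
    simp only [Formula.order, Nat.max_eq_zero_iff] at h
    obtain ⟨L, hL, hφ⟩ := exists_isRegular_defines φ h.2.1
    obtain ⟨K, hK, hψ⟩ := exists_isRegular_defines ψ h.2.2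
    refine ⟨L + K, hL.add hK, fun M n t ht ρ e he k hk => ?_⟩
    rw [Language.mem_add, ind_or, ← hφ M n t ht ρ e he k hk, ← hψ M n t ht ρ e he k hk]
    rfl
  | _, .and φ ψ, h => by
    simp only [Formula.order, Nat.max_eq_zero_iff] at h
    obtain ⟨L, hL, hφ⟩ := exists_isRegular_defines φ h.2.1
    obtain ⟨K, hK, hψ⟩ := exists_isRegular_defines ψ h.2.2
    refine ⟨L ⊓ K, hL.inf hK, fun M n t ht ρ e he k hk => ?_⟩
    rw [Language.mem_inf, ind_and, ← hφ M n t ht ρ e he k hk, ← hψ M n t ht ρ e he k hk]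
    rfl
  | _, .bound J φ, h => by
    simp only [Formula.order, Nat.max_eq_zero_iff] at h
    obtain ⟨L, hL, hφ⟩ := exists_isRegular_defines φ h.2
    exact ⟨L, hL, fun M n t ht ρ e he k hk =>
      boundSem_of_eq_ind J _ (hφ M n t ht ρ e he k hk)⟩
  | _, .box φ, h => by
    simp only [Formula.order, Nat.max_eq_zero_iff] at h
    obtain ⟨L, hL, hφ⟩ := exists_isRegular_defines φ h.2
    exact hφ.delay hL fun M n t ht ρ k hk => ht.boxSem_eq hk _
  | _, .dia φ, h => by
    simp only [Formula.order, Nat.max_eq_zero_iff] at h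
    obtain ⟨L, hL, hφ⟩ := exists_isRegular_defines φ h.2
    exact hφ.delay hL fun M n t ht ρ k hk => ht.diaSem_eq hk _
  | _, .avg φ, h => by
    simp only [Formula.order, Nat.max_eq_zero_iff] at h
    obtain ⟨L, hL, hφ⟩ := exists_isRegular_defines φ h.2
    exact hφ.delay hL fun M n t ht ρ k hk => ht.avgSem_eq hk _
  | _, .mu φ, h => by
    simp only [Formula.order, Nat.max_eq_zero_iff] at h
    obtain ⟨L, hL, hφ⟩ := exists_isRegular_defines φ h.2
    obtain ⟨σ, hσ, D, rfl⟩ := hL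
    exact ⟨_, ⟨σ, hσ, fixDFA False D, rfl⟩, hφ.mu⟩
  | _, .nu φ, h => by
    simp only [Formula.order, Nat.max_eq_zero_iff] at h
    obtain ⟨L, hL, hφ⟩ := exists_isRegular_defines φ h.2
    obtain ⟨σ, hσ, D, rfl⟩ := hL
    exact ⟨_, ⟨σ, hσ, fixDFA True D, rfl⟩, hφ.nu⟩
  | _, .app φ ψ, h => absurd h (Formula.order_app_ne_zero φ ψ)

/-! ### The chain of a word -/

theorem head?_eq_some_and_tail_eq_iff {α : Type*} (x : α) (l l' : List α) :
    l.head? = some x ∧ l.tail = l' ↔ l = x :: l' := by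
  cases l <;> simp

section WordChain

variable {P : Type u} {a b c : P} {w : List Letter} {M : MarkovChain P}

/-- The state at distance `k` from the end of the chain of a word, for `k ≤ w.length`. -/
def backState {S : Type} (s : Fin (w.length + 1) ≃ S) (k : ℕ) : S :=
  s ⟨w.length - k, by omega⟩

/-- The suffix of length `k` of a word `w`, for `k ≤ w.length`. -/
def suffix (w : List Letter) (k : ℕ) : List Letter :=
  w.drop (w.length - k)

theorem suffix_zero : suffix w 0 = [] := by simp [suffix]

theorem suffix_length : suffix w w.length = w := by simp [suffix]

theorem suffix_eq_nil_iff {k : ℕ} (hk : k ≤ w.length) : suffix w k = [] ↔ k = 0 := by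
  rw [← List.length_eq_zero_iff, suffix, List.length_drop]
  omega

theorem suffix_pred {k : ℕ} (hk : k ≤ w.length) : suffix w (k - 1) = (suffix w k).tail := by
  rcases Nat.eq_zero_or_pos k with rfl | h
  · simp [suffix]
  · rw [suffix, suffix, List.tail_drop]
    congr 1
    omega

variable {s : Fin (w.length + 1) ≃ M.State}

theorem IsWordChain.isCountdown (h : IsWordChain a b c w M s) :
    IsCountdown M w.length (backState s) where
  surj x := by
    obtain ⟨i, rfl⟩ := s.surjective x
    refine ⟨w.length - i, by omega, congrArg s (Fin.ext ?_)⟩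
    have := i.2
    simp only
    omega
  inj j hj k hk hjk := by
    have := Fin.mk.inj_iff.1 (s.injective hjk)
    omega
  trans_self k hk := by
    rw [backState, backState, h.trans_eq, if_pos]
    simp only
    omega
  trans_of_ne k hk x hx := by
    obtain ⟨i, rfl⟩ := s.surjective x
    rw [backState, h.trans_eq, if_neg]
    intro hi
    refine hx (congrArg s (Fin.ext ?_))
    simp only at hi ⊢
    omega

theorem IsWordChain.atomSem_a (h : IsWordChain a b c w M s) (k : ℕ) :
    atomSem M (AP.pos a) (backState s k) = ind ((suffix w k).head? = some Letter.a) := by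
  refine congrArg ind (propext ?_)
  rw [h.label_a, suffix, List.head?_drop]
  constructor
  · rintro ⟨i, hi, hw⟩
    rwa [← s.injective hi] at hw
  · exact fun hw => ⟨_, rfl, hw⟩

theorem IsWordChain.atomSem_b (h : IsWordChain a b c w M s) (k : ℕ) :
    atomSem M (AP.pos b) (backState s k) = ind ((suffix w k).head? = some Letter.b) := by
  refine congrArg ind (propext ?_)
  rw [h.label_b, suffix, List.head?_drop]
  constructor
  · rintro ⟨i, hi, hw⟩
    rwa [← s.injective hi] at hw
  · exact fun hw => ⟨_, rfl, hw⟩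

theorem IsWordChain.atomSem_c (h : IsWordChain a b c w M s) {k : ℕ} (hk : k ≤ w.length) :
    atomSem M (AP.pos c) (backState s k) = ind (suffix w k = []) := by
  refine congrArg ind (propext ?_)
  rw [h.label_c, suffix_eq_nil_iff hk, Set.mem_singleton_iff, backState, s.apply_eq_iff_eq,
    Fin.ext_iff, Fin.val_last]
  simp only
  omega

end WordChain

/-! ### The value of the witness on the chain of a word -/

section Witness

variable {P : Type u} (a b c : P) (M : MarkovChain P)

/-- The values of the arguments of `F` in the unfolding of the witness: the value of
`b ∧ ◇(b ∧ ◇(⋯ (b ∧ ◇c)))` with `j` occurrences of `b`. -/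
noncomputable def bChain : ℕ → M.State → unitInterval
  | 0 => atomSem M (AP.pos c)
  | j + 1 => atomSem M (AP.pos b) ⊓ diaSem M (bChain j)

/-- The value of the recursive function `F` of the witness. -/
noncomputable def witnessFun : Dom M.State (Ty.arr Ty.prop Ty.prop) :=
  Formula.sem M
    (.mu (τ := Ty.arr Ty.prop Ty.prop) (.lam
      (.and (.atom (AP.pos a))
        (.dia (.or (.var Var.zero)
          (.app (.var (Var.succ Var.zero))
            (.and (.atom (AP.pos b)) (.dia (.var Var.zero))))))))) Env.nil

theorem witness_value :
    (witness a b c).value M = (witnessFun a b M).toHom (bChain b c M 1) := rfl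

theorem witnessFun_apply (X : M.State → unitInterval) :
    ((witnessFun a b M).toHom X : M.State → unitInterval) =
      atomSem M (AP.pos a) ⊓ diaSem M
        (X ⊔ (witnessFun a b M).toHom (atomSem M (AP.pos b) ⊓ diaSem M X :)) :=
  congrArg (fun f : Dom M.State (Ty.arr Ty.prop Ty.prop) => f.toHom X)
    (OrderHom.map_lfp _).symm

variable {a b c M} {w : List Letter} {s : Fin (w.length + 1) ≃ M.State}

theorem IsWordChain.bChain_eq (h : IsWordChain a b c w M s) (j : ℕ) {k : ℕ} (hk : k ≤ w.length) :
    bChain b c M j (backState s k) = ind (suffix w k = List.replicate j Letter.b) := by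
  induction j generalizing k with
  | zero => exact h.atomSem_c hk
  | succ j ih =>
    change atomSem M (AP.pos b) _ ⊓ diaSem M (bChain b c M j) _ = _
    rw [h.atomSem_b, h.isCountdown.diaSem_eq hk, ih (by omega), ← ind_and, suffix_pred hk,
      head?_eq_some_and_tail_eq_iff, List.replicate_succ]

/-- The fixpoint equation of `F` determines its values backwards from the end of the chain. Each
unfolding reads one `a` and adds one `b` to the word that is expected afterwards. -/
theorem IsWordChain.witnessFun_eq (h : IsWordChain a b c w M s) (j : ℕ) {k : ℕ}
    (hk : k ≤ w.length) :
    ((witnessFun a b M).toHom (bChain b c M j) : M.State → unitInterval) (backState s k) =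
      ind (∃ m, suffix w k =
        List.replicate (m + 1) Letter.a ++ List.replicate (j + m) Letter.b) := by
  induction k generalizing j with
  | zero =>
    rw [witnessFun_apply, Pi.inf_apply, h.atomSem_a, suffix_zero, ind_of_not (by simp),
      ind_of_not (by simp [List.replicate_succ])]
    exact bot_inf_eq _
  | succ k ih =>
    rw [witnessFun_apply, Pi.inf_apply, h.atomSem_a, h.isCountdown.diaSem_eq hk]
    change _ ⊓ (bChain b c M j (backState s k) ⊔
      ((witnessFun a b M).toHom (bChain b c M (j + 1)) : M.State → unitInterval) (backState s k)) = _
    rw [h.bChain_eq j (by omega), ih (j + 1) (by omega), ← ind_or, ← ind_and]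
    have ht : suffix w k = (suffix w (k + 1)).tail := suffix_pred hk
    refine congrArg ind (propext ?_)
    rw [ht]
    constructor
    · rintro ⟨h1, h2 | ⟨m, h2⟩⟩
      · exact ⟨0, (head?_eq_some_and_tail_eq_iff _ _ _).1 ⟨h1, h2⟩⟩
      · refine ⟨m + 1, ((head?_eq_some_and_tail_eq_iff _ _ _).1 ⟨h1, h2⟩).trans ?_⟩
        rw [List.replicate_succ (n := m + 1), List.cons_append, Nat.add_right_comm, Nat.add_assoc]
    · rintro ⟨m, hm⟩
      rw [List.replicate_succ, List.cons_append] at hm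
      rw [hm]
      refine ⟨rfl, ?_⟩
      cases m with
      | zero => exact Or.inl rfl
      | succ m => exact Or.inr ⟨m, by rw [Nat.add_right_comm, Nat.add_assoc]; rfl⟩

theorem IsWordChain.models_witness_iff (h : IsWordChain a b c w M s) :
    M.Models (witness a b c) ↔ w ∈ anbn := by
  have hinit : M.init = backState s w.length := by
    rw [h.init_eq, backState]
    congr 1
    exact Fin.ext (Nat.sub_self _).symm
  rw [MarkovChain.Models, witness_value, hinit, h.witnessFun_eq 1 le_rfl, ind_eq_one, suffix_length]
  constructor
  · rintro ⟨m, hm⟩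
    exact ⟨m + 1, by omega, by rw [hm, Nat.add_comm 1 m]⟩
  · rintro ⟨m, h1, hm⟩
    obtain ⟨m, rfl⟩ := Nat.exists_eq_add_of_le h1
    exact ⟨m, by rw [hm, Nat.add_comm 1 m]⟩

end Witness

theorem order_witness {P : Type u} (a b c : P) : (witness a b c).order = 1 := by
  simp [witness, Formula.order, judgmentOrder, Ty.order]

/-! ### Regular languages -/

/-- The left quotients of the language by the words `aᵐ⁺¹` are distinct, since the quotient by
`aᵐ⁺¹` contains `bᵏ⁺¹` only for `k = m`. -/
theorem not_isRegular_anbn : ¬ anbn.IsRegular := by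
  classical
  intro h
  refine Set.infinite_range_of_injective
    (f := fun m : ℕ => anbn.leftQuotient (List.replicate (m + 1) Letter.a)) ?_
    (h.finite_range_leftQuotient.subset (Set.range_subset_iff.2 fun _ => Set.mem_range_self _))
  intro m m' hm
  have h1 : List.replicate (m + 1) Letter.b ∈
      anbn.leftQuotient (List.replicate (m + 1) Letter.a) :=
    ⟨m + 1, by omega, rfl⟩
  have h2 : List.replicate (m + 1) Letter.b ∈
      anbn.leftQuotient (List.replicate (m' + 1) Letter.a) := by
    have hm' : anbn.leftQuotient (List.replicate (m + 1) Letter.a) =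
      anbn.leftQuotient (List.replicate (m' + 1) Letter.a) := hm
    rwa [← hm']
  obtain ⟨k, -, hk⟩ := h2
  have ha := congrArg (List.count Letter.a) hk
  have hb := congrArg (List.count Letter.b) hk
  simp [List.count_replicate] at ha hb
  omega

/-- Reversal is needed because words are read forwards, and chains are traversed backwards. -/
theorem isRegular_setOf_cons_map_reverse_mem {α β : Type*} {L : Language α} (h : L.IsRegular)
    (x : α) (f : β → α) :
    Language.IsRegular {w : List β | x :: w.reverse.map f ∈ L} := by
  obtain ⟨σ, hσ, D, rfl⟩ := h
  refine Language.IsRegular.reverse (L := {w : List β | x :: w.map f ∈ D.accepts})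
    ⟨σ, hσ, DFA.comap f ⟨D.step, D.step D.start x, D.accept⟩, ?_⟩
  rw [DFA.accepts_comap]
  rfl

/-! ### Separation -/

section Separation

variable {P : Type u} (a b c : P)

/-- The atomic propositions that hold in a state of the chain of a word at which the letter `o` is
read, or at which the word has ended if `o = none`. -/
def letterLabel (o : Option Letter) : Set (AP P) :=
  {p | match p with
    | .pos q => q = a ∧ o = some Letter.a ∨ q = b ∧ o = some Letter.b ∨ q = c ∧ o = none
    | .neg q => ¬ (q = a ∧ o = some Letter.a ∨ q = b ∧ o = some Letter.b ∨ q = c ∧ o = none)}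

theorem pos_mem_letterLabel (o : Option Letter) (q : P) : AP.pos q ∈ letterLabel a b c o ↔
    q = a ∧ o = some Letter.a ∨ q = b ∧ o = some Letter.b ∨ q = c ∧ o = none := Iff.rfl

/-- The chain of a word in which no basic propositions other than `a`, `b` and `c` hold. -/
noncomputable def wordChain (w : List Letter) : MarkovChain P where
  State := Fin (w.length + 1)
  trans i j := if (j : ℕ) = min ((i : ℕ) + 1) w.length then 1 else 0
  sum_trans i := by
    rw [Fintype.sum_eq_single ⟨min (i + 1) w.length, by omega⟩]
    · simp
    · intro j hj
      rw [if_neg fun h => hj (Fin.ext h)]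
      rfl
  label p := {i | p ∈ letterLabel a b c w[(i : ℕ)]?}
  label_neg _ := rfl
  init := 0

variable {a b c}

theorem isWordChain_wordChain (hab : a ≠ b) (hac : a ≠ c) (hbc : b ≠ c) {w : List Letter}
    (hw : w ≠ []) :
    IsWordChain a b c w (wordChain a b c w) (Equiv.refl (Fin (w.length + 1))) where
  ne_nil := hw
  trans_eq _ _ := rfl
  label_a := by
    ext i
    refine (pos_mem_letterLabel a b c _ _).trans ?_
    simp only [hab, hac, true_and, false_and, or_false]
    exact ⟨fun h => ⟨i, rfl, h⟩, fun ⟨j, hj, h⟩ => hj ▸ h⟩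
  label_b := by
    ext i
    refine (pos_mem_letterLabel a b c _ _).trans ?_
    simp only [hab.symm, hbc, true_and, false_and, or_false, false_or]
    exact ⟨fun h => ⟨i, rfl, h⟩, fun ⟨j, hj, h⟩ => hj ▸ h⟩
  label_c := by
    ext i
    refine (pos_mem_letterLabel a b c _ _).trans ?_
    simp only [hac.symm, hbc.symm, true_and, false_and, false_or, List.getElem?_eq_none_iff]
    exact ⟨fun h => Fin.ext (le_antisymm (Fin.is_le i) h), fun h => h ▸ le_rfl⟩
  init_eq := rfl

/-- On the chains of words, a formula of order 0 defines a regular language. -/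
theorem exists_isRegular_models_wordChain (hab : a ≠ b) (hac : a ≠ c) (hbc : b ≠ c)
    {ψ : Proposition P} (hψ : ψ ∈ MuP P) :
    ∃ L : Language Letter, L.IsRegular ∧
      ∀ w ≠ [], ((wordChain a b c w).Models ψ ↔ w ∈ L) := by
  obtain ⟨L, hL, hdef⟩ := exists_isRegular_defines ψ (Nat.le_zero.1 hψ)
  refine ⟨_, isRegular_setOf_cons_map_reverse_mem hL (letterLabel a b c none, ∅)
    fun x => (letterLabel a b c (some x), ∅), fun w hw => ?_⟩
  have hchain := isWordChain_wordChain hab hac hbc hw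
  let s : Fin (w.length + 1) ≃ (wordChain a b c w).State := Equiv.refl _
  have hval := hdef (wordChain a b c w) w.length (backState s)
    hchain.isCountdown Env.nil (fun _ => ∅) (fun k hk x => nomatch x) w.length le_rfl
  have hinit : (wordChain a b c w).init = backState s w.length :=
    Fin.ext (Nat.sub_self _).symm
  have htrace : backTrace (Γ := []) (backState s) (fun _ => ∅) (w.length + 1) =
      (letterLabel a b c none, ∅) ::
        w.reverse.map fun x => (letterLabel a b c (some x), ∅) := by
    change (List.range (w.length + 1)).map (fun j => (letterLabel a b c w[w.length - j]?, ∅)) = _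
    refine List.ext_getElem (by simp) fun i h1 h2 => ?_
    cases i with
    | zero => simp
    | succ i =>
      have hi : i < w.length := by simpa using h2
      have hi' : w[w.length - (i + 1)]? = some w[w.length - 1 - i] := by
        grind
      simp [hi']
  rw [MarkovChain.Models, Formula.value, hinit, hval, ind_eq_one, htrace]
  rfl

theorem exists_wordChain_models_iff_not (hab : a ≠ b) (hac : a ≠ c) (hbc : b ≠ c)
    {ψ : Proposition P} (hψ : ψ ∈ MuP P) :
    ∃ (w : List Letter) (M : MarkovChain P) (s : Fin (w.length + 1) ≃ M.State),
      IsWordChain a b c w M s ∧ ¬ (M.Models (witness a b c) ↔ M.Models ψ) := by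
  by_contra! hcon
  obtain ⟨L, hL, hmod⟩ := exists_isRegular_models_wordChain hab hac hbc hψ
  refine not_isRegular_anbn ?_
  -- `L` may contain the empty word, which has no chain; the intersection removes it.
  have heq : anbn = L ⊓ (lastDFA Set.univ).accepts := by
    ext w
    rw [Language.mem_inf]
    rcases w.eq_nil_or_concat' with rfl | ⟨v, x, rfl⟩
    · refine iff_of_false ?_ fun h => h.2
      rintro ⟨m, h1, hm⟩
      have := congrArg List.length hm
      simp at this
      omega
    · have hw : v ++ [x] ≠ [] := by simp
      have hchain := isWordChain_wordChain hab hac hbc hw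
      rw [append_singleton_mem_lastDFA, ← hmod _ hw, ← hchain.models_witness_iff,
        hcon _ _ _ hchain]
      simp
  rw [heq]
  exact hL.inf (isRegular_lastDFA _)

end Separation

end PHFL

theorem mainTheorem4 {P : Type*} (a b c : P) (hab : a ≠ b) (hac : a ≠ c) (hbc : b ≠ c) :
    -- order-1 PHFL is strictly more expressive than the calculus, in both senses of equivalence
    PHFL.StrictlyMoreExpressive PHFL.Equivalent (PHFL.OrderPHFL P 1) (PHFL.MuP P) ∧
    PHFL.StrictlyMoreExpressive PHFL.SameModels (PHFL.OrderPHFL P 1) (PHFL.MuP P) ∧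
    -- the explicit witness has order 1 and defines a non-regular language on word chains
    (PHFL.witness a b c).order = 1 ∧
    (∀ (w : List PHFL.Letter) (M : PHFL.MarkovChain P) (s : Fin (w.length + 1) ≃ M.State),
      PHFL.IsWordChain a b c w M s → (M.Models (PHFL.witness a b c) ↔ w ∈ PHFL.anbn)) ∧
    ¬ PHFL.anbn.IsRegular ∧
    -- every formula of the calculus differs from the witness on some word chain
    ∀ ψ ∈ PHFL.MuP P,
      ∃ (w : List PHFL.Letter) (M : PHFL.MarkovChain P) (s : Fin (w.length + 1) ≃ M.State),
        PHFL.IsWordChain a b c w M s ∧ ¬ (M.Models (PHFL.witness a b c) ↔ M.Models ψ) := by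
  have hsep := fun ψ (hψ : ψ ∈ PHFL.MuP P) =>
    PHFL.exists_wordChain_models_iff_not hab hac hbc hψ
  have hmem : PHFL.witness a b c ∈ PHFL.OrderPHFL P 1 := (PHFL.order_witness a b c).le
  have hle : ∀ ψ ∈ PHFL.MuP P, ψ ∈ PHFL.OrderPHFL P 1 := fun ψ hψ => Nat.le_succ_of_le hψ
  refine ⟨⟨fun ψ hψ => ⟨ψ, hle ψ hψ, fun _ => rfl⟩, _, hmem, fun ψ hψ h => ?_⟩,
    ⟨fun ψ hψ => ⟨ψ, hle ψ hψ, fun _ => Iff.rfl⟩, _, hmem, fun ψ hψ h => ?_⟩,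
    PHFL.order_witness a b c, fun w M s h => h.models_witness_iff, PHFL.not_isRegular_anbn, hsep⟩
  · obtain ⟨w, M, s, -, hM⟩ := hsep ψ hψ
    exact hM (by rw [PHFL.MarkovChain.Models, PHFL.MarkovChain.Models, h M])
  · obtain ⟨w, M, s, -, hM⟩ := hsep ψ hψ
    exact hM (h M)
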